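/- Let $\mathcal H=L^2(\mathbb R)$ (complex-valued functions, Lebesgue measure). For $q,p\in\mathbb R$ let $(U(q)\psi)(x)=\psi(x-q)$, $(V(p)\psi)(x)=e^{ipx}\psi(x)$ and $W(q,p)=e^{iqp/2}U(q)V(p)$. A \emph{state} is a positive bounded operator on $\mathcal H$ of trace one. A \emph{covariant phase space observable} is a map $G:\mathcal B(\mathbb R^2)\to\mathcal L(\mathcal H)$ that is $\sigma$-additive in the weak operator topology, satisfies $G(Z)\ge 0$ for all $Z$ and $G(\mathbb R^2)=I$, and satisfies $W(q,p)G(Z)W(q,p)^*=G(Z+(q,p))$ for all $q,p\in\mathbb R$ and all Borel sets $Z\subseteq\mathbb R^2$. For every state $T$ the weak integral $$G_T(Z)=\frac1{2\pi}\int_Z W(q,p)\,T\,W(q,p)^*\,dq\,dp,\qquad Z\in\mathcal B(\mathbb R^2),$$ exists, that is, for all $\varphi,\psi\in\mathcal H$ the function $(q,p)\mapsto\langle\varphi,W(q,p)TW(q,p)^*\psi\rangle$ is Lebesgue integrable on $Z$ and $G_T(Z)$ is the bounded operator with $\langle\varphi,G_T(Z)\psi\rangle=\frac1{2\pi}\int_Z\langle\varphi,W(q,p)TW(q,p)^*\psi\rangle\,dq\,dp$;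 moreover, $G_T$ is a covariant phase space observable. The map $T\mapsto G_T$ is injective: if $T_1,T_2$ are states with $T_1\neq T_2$, then $G_{T_1}\neq G_{T_2}$. -/

import Mathlib

open MeasureTheory
open scoped ComplexConjugate

noncomputable section

namespace PhaseSpace

/-- The `σ`-algebra of a measurable space, as a type. -/
abbrev MeasSet (Ω : Type*) [MeasurableSpace Ω] : Type _ := {X : Set Ω // MeasurableSet X}

section General

variable {H : Type*} [NormedAddCommGroup H] [InnerProductSpace ℂ H]

/-- A set function on a `σ`-algebra with values in the bounded operators is an operator measure if
it is `σ`-additive in the weak operator topology. -/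
def IsOperatorMeasure {Ω : Type*} [MeasurableSpace Ω] (E : MeasSet Ω → H →L[ℂ] H) : Prop :=
  ∀ (X : ℕ → Set Ω) (hX : ∀ n, MeasurableSet (X n)), Pairwise (fun m n => Disjoint (X m) (X n)) →
    ∀ φ ψ : H, HasSum (fun n => inner ℂ φ (E ⟨X n, hX n⟩ ψ))
      (inner ℂ φ (E ⟨⋃ n, X n, MeasurableSet.iUnion hX⟩ ψ))

/-- An observable is a normalized positive operator measure. -/
structure IsObservable {Ω : Type*} [MeasurableSpace Ω] (E : MeasSet Ω → H →L[ℂ] H) : Prop where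
  isOperatorMeasure : IsOperatorMeasure E
  isPositive : ∀ X, (E X).IsPositive
  normalized : E ⟨Set.univ, MeasurableSet.univ⟩ = 1

/-- A state is a positive operator of trace one, the trace being computed in an orthonormal
(Hilbert) basis. For a positive operator the sum does not depend on the basis. -/
structure IsState {K : Type} [NormedAddCommGroup K] [InnerProductSpace ℂ K]
    (T : K →L[ℂ] K) : Prop where
  isPositive : T.IsPositive
  trace_eq_one : ∀ (ι : Type) (b : HilbertBasis ι ℂ K), HasSum (fun i => inner ℂ (b i) (T (b i))) 1

/-- `A` is the weak integral of the operator-valued function `F`: all matrix elements of `F` are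
absolutely integrable and their integrals are the matrix elements of `A`. -/
def IsWeakIntegral {α : Type*} [MeasurableSpace α] (μ : Measure α) (F : α → H →L[ℂ] H)
    (A : H →L[ℂ] H) : Prop :=
  ∀ φ ψ : H, Integrable (fun z => inner ℂ φ (F z ψ)) μ ∧
    inner ℂ φ (A ψ) = ∫ z, inner ℂ φ (F z ψ) ∂μ

/-- There is at most one weak integral. -/
theorem IsWeakIntegral.unique {α : Type*} [MeasurableSpace α] {μ : Measure α}
    {F : α → H →L[ℂ] H} {A B : H →L[ℂ] H} (hA : IsWeakIntegral μ F A)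
    (hB : IsWeakIntegral μ F B) : A = B := by
  ext ψ
  refine ext_inner_left ℂ fun φ => ?_
  rw [(hA φ ψ).2, (hB φ ψ).2]

open Classical in
/-- The weak integral of an operator-valued function (zero if there is none). -/
def weakIntegral {α : Type*} [MeasurableSpace α] (μ : Measure α) (F : α → H →L[ℂ] H) :
    H →L[ℂ] H :=
  if h : ∃ A, IsWeakIntegral μ F A then h.choose else 0

theorem IsWeakIntegral.weakIntegral_eq {α : Type*} [MeasurableSpace α] {μ : Measure α}
    {F : α → H →L[ℂ] H} {A : H →L[ℂ] H} (hA : IsWeakIntegral μ F A) :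
    weakIntegral μ F = A := by
  have h : ∃ A, IsWeakIntegral μ F A := ⟨A, hA⟩
  rw [weakIntegral, dif_pos h]
  exact h.choose_spec.unique hA

end General

/-- The Hilbert space `L²(ℝ)` (complex-valued functions, Lebesgue measure). -/
abbrev L2R : Type := Lp ℂ 2 (volume : Measure ℝ)

/-- Space translations: `(U(q)ψ)(x) = ψ(x - q)`. -/
def translationOp (q : ℝ) : L2R →L[ℂ] L2R :=
  (Lp.compMeasurePreservingₗᵢ ℂ (fun x : ℝ => x - q)
    (measurePreserving_sub_right volume q)).toContinuousLinearMap

theorem translationOp_coeFn (q : ℝ) (ψ : L2R) :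
    translationOp q ψ =ᵐ[volume] fun x => ψ (x - q) :=
  Lp.coeFn_compMeasurePreserving ψ (measurePreserving_sub_right volume q)

theorem memLp_boost (p : ℝ) (ψ : L2R) :
    MemLp (fun x : ℝ => Complex.exp (Complex.I * p * x) * ψ x) 2 volume := by
  refine MemLp.of_le (Lp.memLp ψ) ?_ (Filter.Eventually.of_forall fun x => ?_)
  · exact (Continuous.aestronglyMeasurable (by fun_prop)).mul (Lp.aestronglyMeasurable ψ)
  · rw [norm_mul, show Complex.I * (p : ℂ) * x = ((p * x : ℝ) : ℂ) * Complex.I by push_cast; ring,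
      Complex.norm_exp_ofReal_mul_I, one_mul]

/-- Velocity boosts: `(V(p)ψ)(x) = e^{ipx} ψ(x)`. -/
def boostOp (p : ℝ) : L2R →L[ℂ] L2R :=
  LinearMap.mkContinuous
    { toFun := fun ψ => (memLp_boost p ψ).toLp _
      map_add' := fun ψ χ => by
        rw [← MemLp.toLp_add, MemLp.toLp_eq_toLp_iff]
        filter_upwards [Lp.coeFn_add ψ χ] with x hx
        simp only [hx, Pi.add_apply, mul_add]
      map_smul' := fun c ψ => by
        rw [RingHom.id_apply, ← MemLp.toLp_const_smul, MemLp.toLp_eq_toLp_iff]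
        filter_upwards [Lp.coeFn_smul c ψ] with x hx
        simp only [hx, Pi.smul_apply, smul_eq_mul, mul_left_comm] }
    1 fun ψ => by
      rw [one_mul]
      refine Lp.norm_le_norm_of_ae_le ?_
      filter_upwards [(memLp_boost p ψ).coeFn_toLp] with x hx
      refine le_of_eq ((congrArg norm hx).trans ?_)
      rw [norm_mul, show Complex.I * (p : ℂ) * x = ((p * x : ℝ) : ℂ) * Complex.I by
        push_cast; ring, Complex.norm_exp_ofReal_mul_I, one_mul]

theorem boostOp_coeFn (p : ℝ) (ψ : L2R) :
    boostOp p ψ =ᵐ[volume] fun x : ℝ => Complex.exp (Complex.I * p * x) * ψ x :=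
  (memLp_boost p ψ).coeFn_toLp

/-- The projective representation `W(q,p) = e^{iqp/2} U(q) V(p)` of `ℝ²`. -/
def weylOp (z : ℝ × ℝ) : L2R →L[ℂ] L2R :=
  Complex.exp (Complex.I * z.1 * z.2 / 2) • (translationOp z.1 * boostOp z.2)

/-- The translate `Z + w = {z + w | z ∈ Z}` of a Borel set of `ℝ²`. -/
def translate (Z : MeasSet (ℝ × ℝ)) (w : ℝ × ℝ) : MeasSet (ℝ × ℝ) :=
  ⟨(fun z => z + w) '' Z.1, (MeasurableEquiv.addRight w).measurableSet_image.2 Z.2⟩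

/-- A covariant phase space observable is an observable `G` on the Borel sets of `ℝ²` with
`W(q,p) G(Z) W(q,p)^* = G(Z + (q,p))`. -/
structure IsCovariantPhaseSpaceObservable (G : MeasSet (ℝ × ℝ) → L2R →L[ℂ] L2R) : Prop where
  isObservable : IsObservable G
  covariant : ∀ (w : ℝ × ℝ) (Z : MeasSet (ℝ × ℝ)),
    weylOp w * G Z * ContinuousLinearMap.adjoint (weylOp w) = G (translate Z w)

/-- The integrand `W(q,p) T W(q,p)^*`. -/
def displaced (T : L2R →L[ℂ] L2R) (z : ℝ × ℝ) : L2R →L[ℂ] L2R :=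
  weylOp z * T * ContinuousLinearMap.adjoint (weylOp z)

/-- The set function `G_T(Z) = (1/2π) ∫_Z W(q,p) T W(q,p)^* dq dp` generated by `T`. -/
def generatedObservable (T : L2R →L[ℂ] L2R) (Z : MeasSet (ℝ × ℝ)) : L2R →L[ℂ] L2R :=
  (1 / (2 * Real.pi) : ℂ) • weakIntegral (volume.restrict Z.1) (displaced T)

end PhaseSpace

end

/-! Everything rests on Moyal's identity `∫ |⟨φ, W(z)f⟩|² dz = 2π ‖φ‖² ‖f‖²`
(`lintegral_enorm_sq_inner_weylOp`). For fixed `q` the matrix element is, up to a phase, a Fourier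
transform in `p`, so Plancherel and then Tonelli give it. A state is a countable sum of rank-one
operators `|f i⟩⟨f i|` with `∑ ‖f i‖² = 1`. Summing Moyal's identity shows that the diagonal
elements of `W T W*` have total integral `2π ‖φ‖²`. This yields normalization, and by Cauchy–Schwarz
also integrability off the diagonal and boundedness of the sesquilinear form that defines `G_T(Z)`.
Covariance is translation invariance of Lebesgue measure, since the Weyl phases cancel under
conjugation. For injectivity, `G_T` determines each matrix element of `W(z) T W(z)*` for almost
every `z`. Separability provides one `z` that serves a dense set of vectors, and conjugation by the
unitary `W(z)` is injective. -/

namespace PhaseSpace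

/-! ### Plancherel's theorem for the integral Fourier transform -/

section Plancherel

open FourierTransform SchwartzMap
open scoped ENNReal

/-- Both sides define the same distribution: against a test function, the transform moves onto the
test function by duality on `L²` and by Fubini on `L¹`. -/
theorem fourier_toLp_ae_eq {h : ℝ → ℂ} (h1 : Integrable h) (h2 : MemLp h 2) :
    (𝓕 (h2.toLp h) : Lp ℂ 2 (volume : Measure ℝ)) =ᵐ[volume] 𝓕 h := by
  have hcont : Continuous (𝓕 h) :=
    VectorFourier.fourierIntegral_continuous Real.continuous_fourierChar
      (by exact continuous_inner) h1
  refine ae_eq_of_integral_contDiff_smul_eq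
    ((Lp.memLp _).locallyIntegrable (by norm_num)) hcont.locallyIntegrable fun g hg hgc => ?_
  have hgc' : HasCompactSupport (fun x => (g x : ℂ)) := hgc.comp_left (g := fun x : ℝ => (x : ℂ)) (by simp)
  let G : 𝓢(ℝ, ℂ) := hgc'.toSchwartzMap (Complex.ofRealCLM.contDiff.comp hg)
  have hG : ∀ x, G x = g x := fun x => rfl
  have e : 𝓕 (Lp.toTemperedDistribution (h2.toLp h)) G =
      Lp.toTemperedDistribution (𝓕 (h2.toLp h) : Lp ℂ 2 (volume : Measure ℝ)) G := by
    rw [Lp.fourier_toTemperedDistribution_eq]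
  simp only [TemperedDistribution.fourier_apply,
    Lp.toTemperedDistribution_apply (μ := (volume : Measure ℝ))] at e
  have e2 : ∫ x, (𝓕 G) x • (h2.toLp h) x = ∫ x, (𝓕 (G : ℝ → ℂ)) x • h x := by
    refine integral_congr_ae ?_
    filter_upwards [h2.coeFn_toLp] with x hx
    rw [hx, SchwartzMap.fourier_coe]
  have e3 : ∫ x, (𝓕 (G : ℝ → ℂ)) x • h x = ∫ x, G x • 𝓕 h x := by
    have := VectorFourier.integral_fourierIntegral_smul_eq_flip (L := innerₗ ℝ)
      Real.continuous_fourierChar continuous_inner (G.integrable (μ := volume)) h1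
    rw [flip_innerₗ] at this
    exact this
  rw [e2, e3] at e
  simpa [hG] using e.symm

theorem lintegral_enorm_sq_coeFn (f : L2R) : ∫⁻ x, ‖f x‖ₑ ^ 2 = ‖f‖ₑ ^ 2 := by
  rw [Lp.enorm_def, eLpNorm_eq_lintegral_rpow_enorm_toReal (by norm_num) (by norm_num),
    ← ENNReal.rpow_natCast, ← ENNReal.rpow_mul]
  simp

theorem lintegral_enorm_sq_fourier {h : ℝ → ℂ} (h1 : Integrable h) (h2 : MemLp h 2) :
    ∫⁻ ξ, ‖𝓕 h ξ‖ₑ ^ 2 = ∫⁻ x, ‖h x‖ₑ ^ 2 := by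
  calc ∫⁻ ξ, ‖𝓕 h ξ‖ₑ ^ 2 = ∫⁻ ξ, ‖(𝓕 (h2.toLp h) : Lp ℂ 2 (volume : Measure ℝ)) ξ‖ₑ ^ 2 :=
        lintegral_congr_ae ((fourier_toLp_ae_eq h1 h2).mono fun x hx => by simp only [hx])
    _ = ∫⁻ ξ, ‖(h2.toLp h) ξ‖ₑ ^ 2 := by
        rw [lintegral_enorm_sq_coeFn, lintegral_enorm_sq_coeFn, ← ofReal_norm, Lp.norm_fourier_eq, ofReal_norm]
    _ = ∫⁻ x, ‖h x‖ₑ ^ 2 :=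
        lintegral_congr_ae (h2.coeFn_toLp.mono fun x hx => by simp only [hx])

theorem lintegral_enorm_sq_integral_exp {h : ℝ → ℂ} (h1 : Integrable h) (h2 : MemLp h 2) :
    ∫⁻ p : ℝ, ‖∫ x : ℝ, Complex.exp (Complex.I * p * x) * h x‖ₑ ^ 2 =
      ENNReal.ofReal (2 * Real.pi) * ∫⁻ x, ‖h x‖ₑ ^ 2 := by
  have hne : -(2 * Real.pi) ≠ 0 := by simp [Real.pi_ne_zero]
  -- The substitution `p = -2πξ` matches the two Fourier conventions; its Jacobian is the factor
  -- `2π`.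
  let e : ℝ ≃ᵐ ℝ := MeasurableEquiv.mulLeft₀ (-(2 * Real.pi)) hne
  have hmap := Real.smul_map_volume_mul_left hne
  let F : ℝ → ℝ≥0∞ := fun p => ‖∫ x : ℝ, Complex.exp (Complex.I * p * x) * h x‖ₑ ^ 2
  calc ∫⁻ p, F p = ∫⁻ p, F p ∂(ENNReal.ofReal |-(2 * Real.pi)| •
        Measure.map (-(2 * Real.pi) * ·) volume) := by rw [hmap]
    _ = ENNReal.ofReal (2 * Real.pi) * ∫⁻ ξ, F (e ξ) := by
        rw [lintegral_smul_measure, abs_neg, abs_of_pos (by positivity), smul_eq_mul]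
        exact congrArg _ (lintegral_map_equiv F e)
    _ = _ := by
        rw [← lintegral_enorm_sq_fourier h1 h2]
        congr 1
        refine lintegral_congr fun ξ => ?_
        rw [Real.fourier_real_eq_integral_exp_smul]
        change ‖∫ x : ℝ, Complex.exp (Complex.I * ((-(2 * Real.pi) * ξ : ℝ) : ℂ) * x) * h x‖ₑ ^ 2 = _
        congr 2
        refine integral_congr_ae (Filter.Eventually.of_forall fun x => ?_)
        simp only [smul_eq_mul]
        congr 2
        push_cast
        ring

end Plancherel

/-! ### Weyl relations and unitarity -/

section Weyl

theorem weylOp_coeFn (z : ℝ × ℝ) (ψ : L2R) :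
    weylOp z ψ =ᵐ[volume] fun x : ℝ => Complex.exp (Complex.I * z.1 * z.2 / 2) *
      (Complex.exp (Complex.I * z.2 * ((x - z.1 : ℝ) : ℂ)) * ψ (x - z.1)) := by
  have h1 := (measurePreserving_sub_right (volume : Measure ℝ) z.1).quasiMeasurePreserving.ae_eq_comp
    (boostOp_coeFn z.2 ψ)
  filter_upwards [Lp.coeFn_smul (Complex.exp (Complex.I * z.1 * z.2 / 2))
    (translationOp z.1 (boostOp z.2 ψ)), translationOp_coeFn z.1 (boostOp z.2 ψ), h1]
    with x hx hx1 hx2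
  refine hx.trans ?_
  rw [Pi.smul_apply, hx1, smul_eq_mul]
  exact congrArg _ hx2

theorem norm_exp_I_mul_ofReal (x : ℝ) : ‖Complex.exp (Complex.I * x)‖ = 1 := by
  rw [mul_comm, Complex.norm_exp_ofReal_mul_I]

theorem norm_weylOp_apply (z : ℝ × ℝ) (ψ : L2R) : ‖weylOp z ψ‖ = ‖ψ‖ := by
  have h1 : ‖boostOp z.2 ψ‖ = ‖ψ‖ := by
    have hb : ∀ᵐ x, ‖boostOp z.2 ψ x‖ = ‖ψ x‖ := by
      filter_upwards [boostOp_coeFn z.2 ψ] with x hx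
      rw [hx, norm_mul, mul_assoc, ← Complex.ofReal_mul, norm_exp_I_mul_ofReal, one_mul]
    rw [Lp.norm_def, Lp.norm_def, eLpNorm_congr_norm_ae hb]
  have h2 : weylOp z ψ =
      Complex.exp (Complex.I * z.1 * z.2 / 2) • translationOp z.1 (boostOp z.2 ψ) := rfl
  rw [h2, norm_smul, show Complex.I * (z.1 : ℂ) * z.2 / 2 = Complex.I * ((z.1 * z.2 / 2 : ℝ) : ℂ) by
    push_cast; ring, norm_exp_I_mul_ofReal, one_mul, ← h1]
  exact LinearIsometry.norm_map _ _

theorem weylOp_mul (w z : ℝ × ℝ) :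
    weylOp w * weylOp z =
      Complex.exp (Complex.I * ((w.2 * z.1 - w.1 * z.2) / 2 : ℝ)) • weylOp (w + z) := by
  ext1 ψ
  refine Lp.ext ?_
  have h1 := (measurePreserving_sub_right (volume : Measure ℝ) w.1).quasiMeasurePreserving.ae_eq_comp
    (weylOp_coeFn z ψ)
  have h2 := Lp.coeFn_smul (Complex.exp (Complex.I * ((w.2 * z.1 - w.1 * z.2) / 2 : ℝ)))
    (weylOp (w + z) ψ)
  filter_upwards [weylOp_coeFn w (weylOp z ψ), h1, h2, weylOp_coeFn (w + z) ψ]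
    with x hx hx1 hx2 hx3
  refine hx.trans (Eq.trans ?_ hx2.symm)
  rw [Function.comp_apply, Function.comp_apply] at hx1
  rw [Pi.smul_apply, hx3, hx1, smul_eq_mul, Prod.fst_add, Prod.snd_add, sub_sub]
  simp only [← mul_assoc, ← Complex.exp_add]
  congr 2
  push_cast
  ring

theorem weylOp_zero : weylOp 0 = 1 := by
  ext1 ψ
  refine Lp.ext ?_
  filter_upwards [weylOp_coeFn 0 ψ] with x hx
  rw [hx]
  simp

theorem weylOp_mul_weylOp_neg (z : ℝ × ℝ) : weylOp z * weylOp (-z) = 1 := by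
  rw [weylOp_mul, add_neg_cancel, weylOp_zero, Prod.fst_neg, Prod.snd_neg,
    show (z.2 * -z.1 - z.1 * -z.2) / 2 = 0 by ring]
  simp

theorem adjoint_weylOp_mul_self (z : ℝ × ℝ) :
    ContinuousLinearMap.adjoint (weylOp z) * weylOp z = 1 :=
  (ContinuousLinearMap.norm_map_iff_adjoint_comp_self _).1 (norm_weylOp_apply z)

theorem adjoint_weylOp (z : ℝ × ℝ) : ContinuousLinearMap.adjoint (weylOp z) = weylOp (-z) := by
  rw [← mul_one (ContinuousLinearMap.adjoint (weylOp z)), ← weylOp_mul_weylOp_neg z, ← mul_assoc,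
    adjoint_weylOp_mul_self, one_mul]

theorem weylOp_mul_displaced (T : L2R →L[ℂ] L2R) (w z : ℝ × ℝ) :
    weylOp w * displaced T z * ContinuousLinearMap.adjoint (weylOp w) = displaced T (z + w) := by
  have h : weylOp w * displaced T z * ContinuousLinearMap.adjoint (weylOp w) =
      (weylOp w * weylOp z) * T * (weylOp (-z) * weylOp (-w)) := by
    rw [displaced, adjoint_weylOp, adjoint_weylOp]
    simp only [mul_assoc]
  rw [h, weylOp_mul, weylOp_mul, displaced, adjoint_weylOp, add_comm w z, neg_add z w]
  simp only [smul_mul_assoc, mul_smul_comm, smul_smul, ← Complex.exp_add]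
  -- The phases from `W(w)W(z)` and `W(-z)W(-w)` are inverse to each other.
  convert one_smul ℂ _
  rw [← mul_add, ← Complex.ofReal_add]
  simp only [Prod.fst_neg, Prod.snd_neg]
  ring_nf
  simp

theorem displaced_injective (z : ℝ × ℝ) : Function.Injective fun T => displaced T z := by
  intro T₁ T₂ h
  have key (T : L2R →L[ℂ] L2R) : ContinuousLinearMap.adjoint (weylOp z) * displaced T z *
      weylOp z = T := by
    rw [displaced, ← mul_assoc, ← mul_assoc, adjoint_weylOp_mul_self, one_mul, mul_assoc,
      adjoint_weylOp_mul_self, mul_one]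
  rw [← key T₁, ← key T₂]
  exact congrArg (fun A => ContinuousLinearMap.adjoint (weylOp z) * A * weylOp z) h

theorem isPositive_displaced {T : L2R →L[ℂ] L2R} (hT : T.IsPositive) (z : ℝ × ℝ) :
    (displaced T z).IsPositive :=
  hT.conj_adjoint (weylOp z)

end Weyl

/-! ### Square integrability of Weyl matrix elements -/

section Moyal

open scoped ENNReal

theorem inner_weylOp (φ f : L2R) (z : ℝ × ℝ) :
    inner ℂ φ (weylOp z f) = Complex.exp (-(Complex.I * z.1 * z.2 / 2)) *
      ∫ x : ℝ, Complex.exp (Complex.I * z.2 * x) * (conj (φ x) * f (x - z.1)) := by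
  rw [L2.inner_def, ← integral_const_mul]
  refine integral_congr_ae ?_
  filter_upwards [weylOp_coeFn z f] with x hx
  have e : Complex.exp (Complex.I * z.1 * z.2 / 2) *
      Complex.exp (Complex.I * z.2 * ((x - z.1 : ℝ) : ℂ)) =
      Complex.exp (-(Complex.I * z.1 * z.2 / 2)) * Complex.exp (Complex.I * z.2 * x) := by
    rw [← Complex.exp_add, ← Complex.exp_add]
    congr 1
    push_cast
    ring
  rw [RCLike.inner_apply, hx, ← mul_assoc, e]
  ring

theorem measurable_inner_weylOp (φ f : L2R) :
    Measurable fun z : ℝ × ℝ => inner ℂ φ (weylOp z f) := by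
  simp_rw [inner_weylOp]
  have hφ : Measurable φ := (Lp.stronglyMeasurable φ).measurable
  have hf : Measurable f := (Lp.stronglyMeasurable f).measurable
  refine Measurable.mul (by fun_prop) ?_
  refine (StronglyMeasurable.integral_prod_right (f := fun (z : ℝ × ℝ) (x : ℝ) =>
    Complex.exp (Complex.I * z.2 * x) * (conj (φ x) * f (x - z.1))) ?_).measurable
  refine Measurable.stronglyMeasurable ?_
  refine Measurable.mul (by fun_prop) (Measurable.mul ?_ ?_)
  · exact Complex.continuous_conj.measurable.comp (hφ.comp measurable_snd)
  · exact hf.comp (measurable_snd.sub measurable_fst.fst)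

theorem measurable_mul_shift (φ f : L2R) :
    Measurable fun y : ℝ × ℝ => ‖conj (φ y.2) * f (y.2 - y.1)‖ₑ ^ 2 := by
  have hφ : Measurable φ := (Lp.stronglyMeasurable φ).measurable
  have hf : Measurable f := (Lp.stronglyMeasurable f).measurable
  refine Measurable.pow_const (Measurable.enorm (Measurable.mul ?_ ?_)) _
  · exact Complex.continuous_conj.measurable.comp (hφ.comp measurable_snd)
  · exact hf.comp (measurable_snd.sub measurable_fst)

theorem lintegral_enorm_sq_mul_shift (φ f : L2R) :
    ∫⁻ q : ℝ, ∫⁻ x : ℝ, ‖conj (φ x) * f (x - q)‖ₑ ^ 2 = ‖φ‖ₑ ^ 2 * ‖f‖ₑ ^ 2 := by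
  have hφ : Measurable φ := (Lp.stronglyMeasurable φ).measurable
  have hf : Measurable f := (Lp.stronglyMeasurable f).measurable
  rw [lintegral_lintegral_swap (measurable_mul_shift φ f).aemeasurable]
  calc ∫⁻ x : ℝ, ∫⁻ q : ℝ, ‖conj (φ x) * f (x - q)‖ₑ ^ 2
      = ∫⁻ x : ℝ, ‖φ x‖ₑ ^ 2 * ‖f‖ₑ ^ 2 := by
        refine lintegral_congr fun x => ?_
        simp_rw [enorm_mul, mul_pow, RCLike.enorm_conj]
        rw [lintegral_const_mul _ (by fun_prop),
          lintegral_sub_left_eq_self (fun q => ‖f q‖ₑ ^ 2) x, lintegral_enorm_sq_coeFn]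
    _ = _ := by
        rw [lintegral_mul_const _ (by fun_prop), lintegral_enorm_sq_coeFn]

theorem lintegral_enorm_sq_inner_weylOp_right (φ f : L2R) (q : ℝ)
    (hq : ∫⁻ x : ℝ, ‖conj (φ x) * f (x - q)‖ₑ ^ 2 < ∞) :
    ∫⁻ p, ‖inner ℂ φ (weylOp (q, p) f)‖ₑ ^ 2 =
      ENNReal.ofReal (2 * Real.pi) * ∫⁻ x : ℝ, ‖conj (φ x) * f (x - q)‖ₑ ^ 2 := by
  have hshift : MemLp (fun x => f (x - q)) 2 :=
    (Lp.memLp f).comp_measurePreserving (measurePreserving_sub_right volume q)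
  have hφ : MemLp (fun x => conj (φ x)) 2 := (Lp.memLp φ).star
  have h1 : Integrable fun x => conj (φ x) * f (x - q) := hφ.integrable_mul hshift
  have h2 : MemLp (fun x => conj (φ x) * f (x - q)) 2 := by
    refine ⟨h1.aestronglyMeasurable, ?_⟩
    rw [eLpNorm_lt_top_iff_lintegral_rpow_enorm_lt_top (by norm_num) (by norm_num)]
    simpa using hq
  rw [← lintegral_enorm_sq_integral_exp h1 h2]
  refine lintegral_congr fun p => ?_
  rw [inner_weylOp, enorm_mul, show -(Complex.I * ((q, p).1 : ℂ) * ((q, p).2 : ℂ) / 2) =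
    Complex.I * ((-(q * p / 2) : ℝ) : ℂ) by push_cast; ring, ← ofReal_norm,
    norm_exp_I_mul_ofReal, ENNReal.ofReal_one, one_mul]

/-- Moyal's identity (the diagonal case): the matrix elements of the Weyl operators are square
integrable. -/
theorem lintegral_enorm_sq_inner_weylOp (φ f : L2R) :
    ∫⁻ z, ‖inner ℂ φ (weylOp z f)‖ₑ ^ 2 =
      ENNReal.ofReal (2 * Real.pi) * (‖φ‖ₑ ^ 2 * ‖f‖ₑ ^ 2) := by
  have hm : Measurable fun q : ℝ => ∫⁻ x : ℝ, ‖conj (φ x) * f (x - q)‖ₑ ^ 2 :=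
    (measurable_mul_shift φ f).lintegral_prod_right'
  have hfin : ∀ᵐ q : ℝ, ∫⁻ x : ℝ, ‖conj (φ x) * f (x - q)‖ₑ ^ 2 < ∞ := by
    -- The double integral is finite, so for almost every `q` the product is in `L²` and Plancherel
    -- applies.
    refine ae_lt_top hm ?_
    rw [lintegral_enorm_sq_mul_shift]
    exact ENNReal.mul_ne_top (by simp) (by simp)
  rw [Measure.volume_eq_prod, lintegral_prod _
    ((measurable_inner_weylOp φ f).enorm.pow_const 2).aemeasurable,
    ← lintegral_enorm_sq_mul_shift, ← lintegral_const_mul _ hm]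
  exact lintegral_congr_ae
    (hfin.mono fun q hq => lintegral_enorm_sq_inner_weylOp_right φ f q hq)

end Moyal

/-! ### Positive operators and decomposition of states -/

section Positive

variable {H : Type*} [NormedAddCommGroup H] [InnerProductSpace ℂ H] [CompleteSpace H]

theorem exists_inner_eq_inner_apply {T : H →L[ℂ] H} (hT : T.IsPositive) :
    ∃ S : H →L[ℂ] H, IsSelfAdjoint S ∧ ∀ φ ψ, inner ℂ φ (T ψ) = inner ℂ (S φ) (S ψ) := by
  have h0 : 0 ≤ T := (ContinuousLinearMap.nonneg_iff_isPositive T).2 hT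
  have hS : IsSelfAdjoint (CFC.sqrt T) := (CFC.sqrt_nonneg T).isSelfAdjoint
  refine ⟨CFC.sqrt T, hS, fun φ ψ => ?_⟩
  conv_lhs => rw [← CFC.sqrt_mul_sqrt_self T h0]
  exact (hS.isSymmetric φ _).symm

/-- Cauchy–Schwarz for the square root of `T`, then the arithmetic–geometric mean inequality; the
additive form lets diagonal integrability dominate the off-diagonal elements. -/
theorem norm_inner_apply_le {T : H →L[ℂ] H} (hT : T.IsPositive) (φ ψ : H) :
    ‖inner ℂ φ (T ψ)‖ ≤ (‖inner ℂ φ (T φ)‖ + ‖inner ℂ ψ (T ψ)‖) / 2 := by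
  obtain ⟨S, -, hS⟩ := exists_inner_eq_inner_apply hT
  simp only [hS, inner_self_eq_norm_sq_to_K, norm_pow, RCLike.norm_ofReal, abs_norm]
  nlinarith [norm_inner_le_norm (𝕜 := ℂ) (S φ) (S ψ), sq_nonneg (‖S φ‖ - ‖S ψ‖)]

theorem ofReal_norm_inner_apply_self {T : H →L[ℂ] H} (hT : T.IsPositive) (φ : H) :
    ((‖inner ℂ φ (T φ)‖ : ℝ) : ℂ) = inner ℂ φ (T φ) := by
  obtain ⟨S, -, hS⟩ := exists_inner_eq_inner_apply hT
  simp [hS, inner_self_eq_norm_sq_to_K]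

theorem inner_mul_mul_adjoint_apply (A T : H →L[ℂ] H) (φ ψ : H) :
    inner ℂ φ ((A * T * ContinuousLinearMap.adjoint A) ψ) =
      inner ℂ (ContinuousLinearMap.adjoint A φ) (T (ContinuousLinearMap.adjoint A ψ)) :=
  (ContinuousLinearMap.adjoint_inner_left A _ φ).symm

end Positive

/-- Take `f i = √T (b i)` for a Hilbert basis `b` and apply Parseval. Summability of the trace
leaves only countably many nonzero terms, as exchanging sums with limits and integrals requires. -/
theorem IsState.exists_countable_hasSum {K : Type} [NormedAddCommGroup K] [InnerProductSpace ℂ K]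
    [CompleteSpace K] {T : K →L[ℂ] K} (hT : IsState T) :
    ∃ (ι : Type) (_ : Countable ι) (f : ι → K), HasSum (fun i => ‖f i‖ ^ 2) 1 ∧
      ∀ φ ψ, HasSum (fun i => inner ℂ φ (f i) * inner ℂ (f i) ψ) (inner ℂ φ (T ψ)) := by
  obtain ⟨S, hSa, hS⟩ := exists_inner_eq_inner_apply hT.isPositive
  obtain ⟨w, b, -⟩ := exists_hilbertBasis ℂ K
  have h1 : HasSum (fun i => ‖S (b i)‖ ^ 2) (1 : ℝ) := by
    refine Complex.hasSum_ofReal.1 ?_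
    convert! hT.trace_eq_one w b using 2 with i
    · rw [hS, inner_self_eq_norm_sq_to_K, Complex.ofReal_pow]
      rfl
  have h2 (φ ψ : K) : HasSum (fun i => inner ℂ φ (S (b i)) * inner ℂ (S (b i)) ψ)
      (inner ℂ φ (T ψ)) := by
    rw [hS]
    refine (b.hasSum_inner_mul_inner (S φ) (S ψ)).congr_fun fun i => ?_
    exact congrArg₂ (· * ·) (hSa.isSymmetric φ (b i)).symm (hSa.isSymmetric (b i) ψ)
  have hsub : Function.support (fun i => ‖S (b i)‖ ^ 2) = Function.support fun i => S (b i) := by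
    ext i
    simp
  refine ⟨Function.support fun i => S (b i), ?_, fun i => S (b i), ?_, fun φ ψ => ?_⟩
  · rw [← hsub]
    exact h1.summable.countable_support
  · refine (hasSum_subtype_iff_of_support_subset (f := fun i => ‖S (b i)‖ ^ 2) hsub.le).2 h1
  · refine (hasSum_subtype_iff_of_support_subset
      (f := fun i => inner ℂ φ (S (b i)) * inner ℂ (S (b i)) ψ) ?_).2 (h2 φ ψ)
    intro i hi
    contrapose! hi
    simp only [Function.mem_support, not_not] at hi
    simp [hi]

/-! ### Integrability of the matrix elements of `W T W*` -/

section Displaced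

open scoped ENNReal

variable {T : L2R →L[ℂ] L2R}

theorem inner_displaced (T : L2R →L[ℂ] L2R) (z : ℝ × ℝ) (φ ψ : L2R) :
    inner ℂ φ (displaced T z ψ) =
      inner ℂ (ContinuousLinearMap.adjoint (weylOp z) φ)
        (T (ContinuousLinearMap.adjoint (weylOp z) ψ)) :=
  inner_mul_mul_adjoint_apply (weylOp z) T φ ψ

theorem IsState.exists_hasSum_inner_displaced (hT : IsState T) :
    ∃ (ι : Type) (_ : Countable ι) (f : ι → L2R), HasSum (fun i => ‖f i‖ ^ 2) 1 ∧
      ∀ z φ ψ, HasSum (fun i => inner ℂ φ (weylOp z (f i)) * inner ℂ (weylOp z (f i)) ψ)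
        (inner ℂ φ (displaced T z ψ)) := by
  obtain ⟨ι, hι, f, h1, h2⟩ := hT.exists_countable_hasSum
  refine ⟨ι, hι, f, h1, fun z φ ψ => ?_⟩
  have h := h2 (ContinuousLinearMap.adjoint (weylOp z) φ) (ContinuousLinearMap.adjoint (weylOp z) ψ)
  simpa only [inner_displaced, ContinuousLinearMap.adjoint_inner_left,
    ContinuousLinearMap.adjoint_inner_right] using h

theorem IsState.measurable_inner_displaced (hT : IsState T) (φ ψ : L2R) :
    Measurable fun z => inner ℂ φ (displaced T z ψ) := by
  obtain ⟨ι, hι, f, -, h⟩ := hT.exists_hasSum_inner_displaced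
  -- Countability of `ι` makes the filter of finite subsets countably generated.
  refine measurable_of_tendsto_metrizable' (Filter.atTop : Filter (Finset ι))
    (f := fun s z => ∑ i ∈ s, inner ℂ φ (weylOp z (f i)) * inner ℂ (weylOp z (f i)) ψ)
    (fun s => ?_) (tendsto_pi_nhds.2 fun z => h z φ ψ)
  refine Finset.measurable_fun_sum _ fun i _ => (measurable_inner_weylOp φ (f i)).mul ?_
  simp_rw [← inner_conj_symm _ ψ]
  exact Complex.continuous_conj.measurable.comp (measurable_inner_weylOp ψ (f i))

theorem IsState.lintegral_enorm_inner_displaced_self (hT : IsState T) (φ : L2R) :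
    ∫⁻ z, ‖inner ℂ φ (displaced T z φ)‖ₑ = ENNReal.ofReal (2 * Real.pi * ‖φ‖ ^ 2) := by
  obtain ⟨ι, hι, f, h1, h⟩ := hT.exists_hasSum_inner_displaced
  have hz (z : ℝ × ℝ) : ‖inner ℂ φ (displaced T z φ)‖ₑ =
      ∑' i, ‖inner ℂ φ (weylOp z (f i))‖ₑ ^ 2 := by
    have h2 : HasSum (fun i => ‖inner ℂ φ (weylOp z (f i))‖ ^ 2)
        ‖inner ℂ φ (displaced T z φ)‖ := by
      have h3 := h z φ φ
      rw [← ofReal_norm_inner_apply_self (isPositive_displaced hT.isPositive z)] at h3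
      have h4 (i : ι) : inner ℂ φ (weylOp z (f i)) * inner ℂ (weylOp z (f i)) φ =
          ((‖inner ℂ φ (weylOp z (f i))‖ ^ 2 : ℝ) : ℂ) := by
        rw [← inner_conj_symm (weylOp z (f i)) φ, RCLike.mul_conj]
        push_cast
        rfl
      simp only [h4] at h3
      exact_mod_cast h3
    rw [← ofReal_norm, ← h2.tsum_eq, ENNReal.ofReal_tsum_of_nonneg (fun i => by positivity)
      h2.summable]
    exact tsum_congr fun i => by rw [ENNReal.ofReal_pow (norm_nonneg _), ofReal_norm]
  simp_rw [hz]
  rw [lintegral_tsum fun i => ((measurable_inner_weylOp φ (f i)).enorm.pow_const 2).aemeasurable]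
  simp_rw [lintegral_enorm_sq_inner_weylOp]
  rw [ENNReal.tsum_mul_left, ENNReal.tsum_mul_left]
  have h5 : ∑' i, ‖f i‖ₑ ^ 2 = 1 := by
    rw [← ENNReal.ofReal_one, ← h1.tsum_eq, ENNReal.ofReal_tsum_of_nonneg (fun i => by positivity)
      h1.summable]
    exact tsum_congr fun i => by rw [ENNReal.ofReal_pow (norm_nonneg _), ofReal_norm]
  rw [h5, mul_one, ENNReal.ofReal_mul (p := 2 * Real.pi) (by positivity), ENNReal.ofReal_pow (norm_nonneg _),
    ofReal_norm]

theorem IsState.integrable_inner_displaced_self (hT : IsState T) (φ : L2R) :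
    Integrable fun z => inner ℂ φ (displaced T z φ) := by
  refine ⟨(hT.measurable_inner_displaced φ φ).aestronglyMeasurable, ?_⟩
  rw [HasFiniteIntegral, hT.lintegral_enorm_inner_displaced_self]
  exact ENNReal.ofReal_lt_top

theorem IsState.integral_norm_inner_displaced_self (hT : IsState T) (φ : L2R) :
    ∫ z, ‖inner ℂ φ (displaced T z φ)‖ = 2 * Real.pi * ‖φ‖ ^ 2 := by
  rw [integral_norm_eq_lintegral_enorm (hT.measurable_inner_displaced φ φ).aestronglyMeasurable,
    hT.lintegral_enorm_inner_displaced_self, ENNReal.toReal_ofReal (by positivity)]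

theorem IsState.integrable_inner_displaced (hT : IsState T) (φ ψ : L2R) :
    Integrable fun z => inner ℂ φ (displaced T z ψ) := by
  refine (((hT.integrable_inner_displaced_self φ).norm.add
    (hT.integrable_inner_displaced_self ψ).norm).div_const 2).mono'
    (hT.measurable_inner_displaced φ ψ).aestronglyMeasurable
    (Filter.Eventually.of_forall fun z => ?_)
  exact norm_inner_apply_le (isPositive_displaced hT.isPositive z) φ ψ

theorem IsState.norm_setIntegral_inner_displaced_le (hT : IsState T) (Z : Set (ℝ × ℝ))
    (φ ψ : L2R) :
    ‖∫ z in Z, inner ℂ φ (displaced T z ψ)‖ ≤ Real.pi * (‖φ‖ ^ 2 + ‖ψ‖ ^ 2) := by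
  have hφ := (hT.integrable_inner_displaced_self φ).norm
  have hψ := (hT.integrable_inner_displaced_self ψ).norm
  have hφψ := (hT.integrable_inner_displaced φ ψ).norm
  calc ‖∫ z in Z, inner ℂ φ (displaced T z ψ)‖
      ≤ ∫ z in Z, ‖inner ℂ φ (displaced T z ψ)‖ := norm_integral_le_integral_norm _
    _ ≤ ∫ z, ‖inner ℂ φ (displaced T z ψ)‖ :=
        setIntegral_le_integral hφψ (Filter.Eventually.of_forall fun z => norm_nonneg _)
    _ ≤ ∫ z, (‖inner ℂ φ (displaced T z φ)‖ + ‖inner ℂ ψ (displaced T z ψ)‖) / 2 :=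
        integral_mono hφψ ((hφ.add hψ).div_const 2) fun z =>
          norm_inner_apply_le (isPositive_displaced hT.isPositive z) φ ψ
    _ = Real.pi * (‖φ‖ ^ 2 + ‖ψ‖ ^ 2) := by
        rw [integral_div, integral_add hφ hψ, hT.integral_norm_inner_displaced_self,
          hT.integral_norm_inner_displaced_self]
        ring

end Displaced

/-- A sesquilinear form bounded by a multiple of the sum of the squared norms is bounded. -/
theorem norm_sesq_le {H : Type*} [NormedAddCommGroup H] [NormedSpace ℂ H]
    (B : H →ₗ⋆[ℂ] H →ₗ[ℂ] ℂ) {C : ℝ} (hB : ∀ φ ψ, ‖B φ ψ‖ ≤ C * (‖φ‖ ^ 2 + ‖ψ‖ ^ 2)) (φ ψ : H) :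
    ‖B φ ψ‖ ≤ 2 * C * ‖φ‖ * ‖ψ‖ := by
  rcases eq_or_ne φ 0 with rfl | hφ
  · simp
  rcases eq_or_ne ψ 0 with rfl | hψ
  · simp
  have hφ' : 0 < ‖φ‖ := norm_pos_iff.2 hφ
  have hψ' : 0 < ‖ψ‖ := norm_pos_iff.2 hψ
  -- Normalizing both vectors turns the sum of squares into `2`.
  have h := hB ((‖φ‖⁻¹ : ℂ) • φ) ((‖ψ‖⁻¹ : ℂ) • ψ)
  rw [map_smul, LinearMap.map_smulₛₗ, LinearMap.smul_apply] at h
  simp only [norm_smul, smul_eq_mul, norm_mul, norm_inv, RCLike.norm_conj, map_inv₀,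
    Complex.norm_real, norm_norm, inv_mul_cancel₀ hφ'.ne', inv_mul_cancel₀ hψ'.ne'] at h
  rw [← mul_assoc, ← mul_inv, inv_mul_le_iff₀ (by positivity)] at h
  linarith

/-! ### Existence, covariance and injectivity of `G_T` -/

section WeakIntegral

variable {T : L2R →L[ℂ] L2R}

theorem IsState.exists_isWeakIntegral (hT : IsState T) (Z : Set (ℝ × ℝ)) :
    ∃ A, IsWeakIntegral (volume.restrict Z) (displaced T) A := by
  have hi (φ ψ : L2R) : Integrable (fun z => inner ℂ φ (displaced T z ψ)) (volume.restrict Z) :=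
    (hT.integrable_inner_displaced φ ψ).integrableOn
  let B : L2R →ₗ⋆[ℂ] L2R →ₗ[ℂ] ℂ :=
    LinearMap.mk₂'ₛₗ (starRingEnd ℂ) (RingHom.id ℂ)
      (fun φ ψ => ∫ z in Z, inner ℂ φ (displaced T z ψ))
      (fun φ φ' ψ => by
        simp only [inner_add_left]
        exact integral_add (hi _ _) (hi _ _))
      (fun c φ ψ => by
        simp only [inner_smul_left]
        exact integral_const_mul _ _)
      (fun φ ψ ψ' => by
        simp only [map_add, inner_add_right]
        exact integral_add (hi _ _) (hi _ _))
      (fun c φ ψ => by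
        simp only [map_smul, inner_smul_right]
        exact integral_const_mul _ _)
  let B' : L2R →L⋆[ℂ] L2R →L[ℂ] ℂ :=
    B.mkContinuous₂ (2 * Real.pi) (norm_sesq_le B (hT.norm_setIntegral_inner_displaced_le Z))
  -- The operator representing `B'` acts in the first slot of the inner product; the adjoint moves
  -- it to the second.
  refine ⟨ContinuousLinearMap.adjoint (InnerProductSpace.continuousLinearMapOfBilin B'),
    fun φ ψ => ⟨hi φ ψ, ?_⟩⟩
  rw [ContinuousLinearMap.adjoint_inner_right,
    InnerProductSpace.continuousLinearMapOfBilin_apply]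
  rfl

theorem IsState.inner_generatedObservable (hT : IsState T) (φ ψ : L2R) (Z : MeasSet (ℝ × ℝ)) :
    inner ℂ φ (generatedObservable T Z ψ) =
      (1 / (2 * Real.pi) : ℂ) * ∫ z in Z.1, inner ℂ φ (displaced T z ψ) := by
  obtain ⟨A, hA⟩ := hT.exists_isWeakIntegral Z.1
  rw [generatedObservable, hA.weakIntegral_eq, smul_apply, inner_smul_right,
    (hA φ ψ).2]

theorem IsState.inner_generatedObservable_self (hT : IsState T) (φ : L2R)
    (Z : MeasSet (ℝ × ℝ)) :
    inner ℂ φ (generatedObservable T Z φ) =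
      ((1 / (2 * Real.pi) * ∫ z in Z.1, ‖inner ℂ φ (displaced T z φ)‖ : ℝ) : ℂ) := by
  rw [hT.inner_generatedObservable]
  push_cast
  rw [← integral_complex_ofReal]
  simp only [ofReal_norm_inner_apply_self (isPositive_displaced hT.isPositive _)]

theorem IsState.isObservable_generatedObservable (hT : IsState T) :
    IsObservable (generatedObservable T) where
  isOperatorMeasure X hX hd φ ψ := by
    simp only [hT.inner_generatedObservable]
    exact (hasSum_integral_iUnion hX hd (hT.integrable_inner_displaced φ ψ).integrableOn).mul_left _
  isPositive Z := by
    rw [ContinuousLinearMap.isPositive_iff_complex]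
    intro φ
    rw [← inner_conj_symm, hT.inner_generatedObservable_self, Complex.conj_ofReal]
    refine ⟨by simp, ?_⟩
    rw [RCLike.re_to_complex, Complex.ofReal_re]
    exact mul_nonneg (by positivity) (integral_nonneg fun z => norm_nonneg _)
  normalized := by
    -- By polarization the quadratic form determines the operator.
    refine ContinuousLinearMap.coe_injective ((ext_inner_map _ _).1 fun φ => ?_)
    rw [ContinuousLinearMap.coe_coe, ← inner_conj_symm, hT.inner_generatedObservable_self,
      Complex.conj_ofReal, setIntegral_univ, hT.integral_norm_inner_displaced_self]
    rw [← mul_assoc, one_div_mul_cancel (by positivity), one_mul]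
    simp [inner_self_eq_norm_sq_to_K]

theorem IsState.isCovariant_generatedObservable (hT : IsState T) :
    IsCovariantPhaseSpaceObservable (generatedObservable T) where
  isObservable := hT.isObservable_generatedObservable
  covariant w Z := by
    ext1 ψ
    refine ext_inner_left ℂ fun φ => ?_
    rw [inner_mul_mul_adjoint_apply, hT.inner_generatedObservable, hT.inner_generatedObservable]
    congr 1
    have h2 := (measurePreserving_add_right (volume : Measure (ℝ × ℝ)) w).setIntegral_image_emb
      (MeasurableEquiv.addRight w).measurableEmbedding
      (fun z => inner ℂ φ (displaced T z ψ)) Z.1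
    refine Eq.trans ?_ h2.symm
    refine integral_congr_ae (Filter.Eventually.of_forall fun z => ?_)
    simp only [← weylOp_mul_displaced, inner_mul_mul_adjoint_apply]

theorem IsState.eq_of_generatedObservable_eq {T₁ T₂ : L2R →L[ℂ] L2R} (h₁ : IsState T₁)
    (h₂ : IsState T₂) (h : generatedObservable T₁ = generatedObservable T₂) : T₁ = T₂ := by
  have hae (φ ψ : L2R) : ∀ᵐ z, inner ℂ φ (displaced T₁ z ψ) = inner ℂ φ (displaced T₂ z ψ) := by
    refine (h₁.integrable_inner_displaced φ ψ).ae_eq_of_forall_setIntegral_eq _ _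
      (h₂.integrable_inner_displaced φ ψ) fun Z hZ _ => ?_
    have h3 := congrArg (fun G => inner ℂ φ (G ⟨Z, hZ⟩ ψ)) h
    simp only [h₁.inner_generatedObservable, h₂.inner_generatedObservable] at h3
    exact mul_left_cancel₀ (by simp [Real.pi_ne_zero]) h3
  have : Fact ((2 : ENNReal) ≠ ⊤) := ⟨by norm_num⟩
  have hd := TopologicalSpace.denseRange_denseSeq L2R
  -- The null sets depend on the vectors; a countable dense family needs only countably many, so a
  -- common good `z` exists.
  obtain ⟨z, hz⟩ := (ae_all_iff.2 fun m => ae_all_iff.2 fun n =>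
    hae (TopologicalSpace.denseSeq L2R m) (TopologicalSpace.denseSeq L2R n)).exists
  refine displaced_injective z ?_
  have h4 (n : ℕ) : displaced T₁ z (TopologicalSpace.denseSeq L2R n) =
      displaced T₂ z (TopologicalSpace.denseSeq L2R n) := by
    refine ext_inner_left ℂ fun φ => ?_
    exact congrFun (hd.equalizer
      (g := fun φ => inner ℂ φ (displaced T₁ z (TopologicalSpace.denseSeq L2R n)))
      (h := fun φ => inner ℂ φ (displaced T₂ z (TopologicalSpace.denseSeq L2R n)))
      (by fun_prop) (by fun_prop) (funext fun m => hz m n)) φ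
  exact DFunLike.coe_injective (hd.equalizer (displaced T₁ z).continuous
    (displaced T₂ z).continuous (funext h4))

end WeakIntegral

end PhaseSpace

theorem mainTheorem8 :
    (∀ T : PhaseSpace.L2R →L[ℂ] PhaseSpace.L2R, PhaseSpace.IsState T →
      (∀ (φ ψ : PhaseSpace.L2R) (Z : PhaseSpace.MeasSet (ℝ × ℝ)),
        MeasureTheory.IntegrableOn (fun z => inner ℂ φ (PhaseSpace.displaced T z ψ)) Z.1 ∧
        inner ℂ φ (PhaseSpace.generatedObservable T Z ψ) =
          (1 / (2 * Real.pi) : ℂ) * ∫ z in Z.1, inner ℂ φ (PhaseSpace.displaced T z ψ)) ∧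
      PhaseSpace.IsCovariantPhaseSpaceObservable (PhaseSpace.generatedObservable T)) ∧
    (∀ T₁ T₂ : PhaseSpace.L2R →L[ℂ] PhaseSpace.L2R,
      PhaseSpace.IsState T₁ → PhaseSpace.IsState T₂ → T₁ ≠ T₂ →
        PhaseSpace.generatedObservable T₁ ≠ PhaseSpace.generatedObservable T₂) :=
  ⟨fun _ hT => ⟨fun φ ψ Z => ⟨(hT.integrable_inner_displaced φ ψ).integrableOn,
    hT.inner_generatedObservable φ ψ Z⟩, hT.isCovariant_generatedObservable⟩,
    fun _ _ h₁ h₂ hne h => hne (h₁.eq_of_generatedObservable_eq h₂ h)⟩
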